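/- Let $k\ge 0$, let $a\le b$ be real numbers and let $f_1,\dots,f_k$ be continuous (real- or complex-valued) functions on $[a,b]$. Then the integrals $$ I=\int_{a<x_1<\cdots<x_k<b}\det\bigl(f_i(x_j)\bigr)_{1\le i,j\le k}\,dx_1\cdots dx_k,\qquad I_i=\int_{a<x<b}f_i(x)\,dx, $$ $$ I_{ij}=\int_{a<x<y<b}\bigl(f_i(x)f_j(y)-f_j(x)f_i(y)\bigr)\,dx\,dy \qquad(1\le i,j\le k) $$ converge absolutely, and the following holds. If $k$ is even, then $I$ is the Pfaffian of the $k\times k$ skew-symmetric matrix $(I_{ij})_{1\le i,j\le k}$. If $k$ is odd, then $I$ is the Pfaffian of the $(k+1)\times(k+1)$ skew-symmetric matrix $(I_{ij})_{0\le i,j\le k}$ obtained by adjoining a zeroth row and a zeroth column with $I_{00}=0$ and $I_{0i}=-I_{i0}=I_i$ for $1\le i\le k$. Here the Pfaffian of a skew-symmetric $n\times n$ matrix $A$ with rows and columns indexed by $1,\dots,n$ (in the bordered case, by $0,\dots,k$, renumbered in order), $n$ even, is $$\operatorname{Pf}(A)=\sum_{\pi}\operatorname{sgn}(\pi)\,A_{\pi(1),\pi(2)}A_{\pi(3),\pi(4)}\cdots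 A_{\pi(n-1),\pi(n)},$$ summed over all permutations $\pi$ of $\{1,\dots,n\}$ with $\pi(2r-1)<\pi(2r)$ for $1\le r\le n/2$ and $\pi(1)<\pi(3)<\cdots<\pi(n-1)$; the Pfaffian of the empty matrix is $1$. (For $k=0$ the integral $I$ is taken to be $1$.) -/

import Mathlib

open MeasureTheory

/-- The Pfaffian of an `n × n` matrix, `n` even: the signed sum of
`A (π 0) (π 1) * A (π 2) (π 3) * ⋯ * A (π (n-2)) (π (n-1))` over all permutations `π` with
`π 0 < π 1`, `π 2 < π 3`, …, `π (n-2) < π (n-1)` and `π 0 < π 2 < ⋯ < π (n-2)`. -/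
def pfaffian {R : Type*} [CommRing R] {n : ℕ} (_hn : Even n) (A : Matrix (Fin n) (Fin n) R) : R :=
  ∑ π : Equiv.Perm (Fin n) with
      (∀ i : Fin (n / 2), π ⟨2 * i, by omega⟩ < π ⟨2 * i + 1, by omega⟩) ∧
      (∀ i j : Fin (n / 2), i < j → π ⟨2 * i, by omega⟩ < π ⟨2 * j, by omega⟩),
    ((Equiv.Perm.sign π : ℤ) : R) *
      ∏ i : Fin (n / 2), A (π ⟨2 * i, by omega⟩) (π ⟨2 * i + 1, by omega⟩)

/-- The region `a < x₁ < ⋯ < x_k < b` in `ℝᵏ`. -/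
def orderedRegion (k : ℕ) (a b : ℝ) : Set (Fin k → ℝ) :=
  {x | (∀ i, a < x i ∧ x i < b) ∧ StrictMono x}

/-- The region `a < x < y < b` in `ℝ²`. -/
def orderedPairs (a b : ℝ) : Set (ℝ × ℝ) :=
  {p | a < p.1 ∧ p.1 < p.2 ∧ p.2 < b}

/-- The matrix `I_ij = ∫_{a<x<y<b} (f_i(x) f_j(y) - f_j(x) f_i(y)) dx dy`. -/
noncomputable def pairMatrix {𝕜 : Type*} [RCLike 𝕜] {k : ℕ} (a b : ℝ) (f : Fin k → ℝ → 𝕜) :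
    Matrix (Fin k) (Fin k) 𝕜 :=
  Matrix.of fun i j => ∫ p in orderedPairs a b, (f i p.1 * f j p.2 - f j p.1 * f i p.2)

/-- The skew-symmetric bordering of `A` by a zeroth row `(0, v)` and a zeroth column `(0, -v)`. -/
def skewBorder {R : Type*} [CommRing R] {k : ℕ} (v : Fin k → R) (A : Matrix (Fin k) (Fin k) R) :
    Matrix (Fin (k + 1)) (Fin (k + 1)) R :=
  Matrix.of (Fin.cons (Fin.cons 0 v) fun i => Fin.cons (-v i) (A i))

/-!
The formula is proved in the even case for an arbitrary σ-finite measure `μ` on the line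
(`integral_strictMono_det_eq_pfaffian`); the odd case is then an instance of it.

For `n` even, let `D x = det (g i (x j))` and let `W x` be the product of the signs of
`x 1 - x 0`, `x 3 - x 2`, …. The sum of `D (x ∘ σ) * W (x ∘ σ)` over all permutations `σ` equals
`D x * ∑ σ, sgn σ * W (x ∘ σ)`. For increasing `x` the second factor is the Pfaffian sum, over all
permutations, of the matrix `sgn (j - i)`, which is a constant `c = 2 ^ (n / 2) * (n / 2)!`; since
`D` is alternating, the sum is for every `x` equal to `c` times the sum over `σ` of the restriction
of `D` to increasing tuples, evaluated at `x ∘ σ` (`sum_detMulOrderSign_comp_perm`). Integrating and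
using that the product measure is invariant under permutations, `∫ D * W` is `c` times the integral
of `D` over increasing tuples. On the other hand, expanding `D` and applying Fubini's theorem pair
by pair turns `∫ D * W` into the Pfaffian sum, over all permutations, of the matrix of double
integrals (`integral_detMulOrderSign`), which is `c` times its Pfaffian.

Two combinatorial facts enter. The sum over all permutations is `c` times the Pfaffian, because each
coset of the hyperoctahedral group contains exactly one permutation with sorted pairs
(`sum_eq_card_mul_sum_pairsSorted`). The matrix `sgn (j - i)` has Pfaffian `1`, because exchanging
the values `2 * r` and `2 * r + 1` cancels all permutations that do not pair them
(`sum_pfaffianTerm_orderSign`).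

For an odd number of functions, a unit point mass is added at the left end point `a`, together with
the indicator function of `{a}` as a zeroth function. In an increasing tuple exactly the zeroth
variable must sit at `a` for the determinant not to vanish, so the integral is unchanged
(`integral_det_atomCons`), while the matrix of double integrals becomes the bordered one
(`pairMatrix_atomCons`).
-/

/-! ### Pfaffians as sums over all permutations -/

/-- The bijection `(i, c) ↦ 2 * i + c`, which groups the positions `0, …, n - 1` (for `n` even)
into consecutive pairs. -/
def pairIndex {n : ℕ} (hn : Even n) : Fin (n / 2) × Fin 2 ≃ Fin n :=
  finProdFinEquiv.trans (finCongr (Nat.div_mul_cancel hn.two_dvd))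

lemma pairIndex_val {n : ℕ} (hn : Even n) (i : Fin (n / 2)) (c : Fin 2) :
    (pairIndex hn (i, c) : ℕ) = 2 * i + c := by
  simp [pairIndex, finProdFinEquiv]; omega

lemma pairIndex_zero {n : ℕ} (hn : Even n) (i : Fin (n / 2)) :
    pairIndex hn (i, 0) = ⟨2 * i, by omega⟩ := Fin.ext (by simp [pairIndex_val])

lemma pairIndex_one {n : ℕ} (hn : Even n) (i : Fin (n / 2)) :
    pairIndex hn (i, 1) = ⟨2 * i + 1, by omega⟩ := Fin.ext (by simp [pairIndex_val])

lemma prod_pairIndex {n : ℕ} (hn : Even n) {M : Type*} [CommMonoid M] (F : Fin n → M) :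
    ∏ j, F j = ∏ i, F (pairIndex hn (i, 0)) * F (pairIndex hn (i, 1)) := by
  rw [← (pairIndex hn).prod_comp, Fintype.prod_prod_type]
  simp [Fin.prod_univ_two]

/-- The summand of the Pfaffian of `A` belonging to a permutation `σ`. -/
def pfaffianTerm {R : Type*} [CommRing R] {n : ℕ} (hn : Even n) (A : Matrix (Fin n) (Fin n) R)
    (σ : Equiv.Perm (Fin n)) : R :=
  ((Equiv.Perm.sign σ : ℤ) : R) *
    ∏ i, A (σ (pairIndex hn (i, 0))) (σ (pairIndex hn (i, 1)))

/-- The permutations over which the Pfaffian is summed: each pair is increasing, and the pairs are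
ordered by their first entries. -/
def PairsSorted {n : ℕ} (hn : Even n) (σ : Equiv.Perm (Fin n)) : Prop :=
  (∀ i, σ (pairIndex hn (i, 0)) < σ (pairIndex hn (i, 1))) ∧
    StrictMono fun i => σ (pairIndex hn (i, 0))

open Classical in
lemma pfaffian_eq_sum_pfaffianTerm {R : Type*} [CommRing R] {n : ℕ} (hn : Even n)
    (A : Matrix (Fin n) (Fin n) R) :
    pfaffian hn A = ∑ σ with PairsSorted hn σ, pfaffianTerm hn A σ := by
  simp only [pfaffian, pfaffianTerm, PairsSorted, pairIndex_zero, pairIndex_one, StrictMono]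

/-- The permutation of the positions that permutes the pairs by `k.1` and then the two places within
each pair `i` by `k.2 i`. These are the elements of the hyperoctahedral group. -/
def blockPerm {n : ℕ} (hn : Even n)
    (k : Equiv.Perm (Fin (n / 2)) × (Fin (n / 2) → Equiv.Perm (Fin 2))) : Equiv.Perm (Fin n) :=
  (pairIndex hn).permCongr (Equiv.prodCongrRight k.2 * Equiv.prodCongrLeft fun _ => k.1)

lemma blockPerm_pairIndex {n : ℕ} (hn : Even n)
    (k : Equiv.Perm (Fin (n / 2)) × (Fin (n / 2) → Equiv.Perm (Fin 2))) (i : Fin (n / 2))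
    (c : Fin 2) :
    blockPerm hn k (pairIndex hn (i, c)) = pairIndex hn (k.1 i, k.2 (k.1 i) c) := by
  simp [blockPerm, Equiv.permCongr_apply]

lemma sign_blockPerm {n : ℕ} (hn : Even n)
    (k : Equiv.Perm (Fin (n / 2)) × (Fin (n / 2) → Equiv.Perm (Fin 2))) :
    Equiv.Perm.sign (blockPerm hn k) = ∏ i, Equiv.Perm.sign (k.2 i) := by
  rw [blockPerm, Equiv.Perm.sign_permCongr, map_mul, Equiv.Perm.sign_prodCongrRight,
    Equiv.Perm.sign_prodCongrLeft]
  simp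

lemma perm_fin_two_eq (ε : Equiv.Perm (Fin 2)) : ε = 1 ∨ ε = Equiv.swap 0 1 := by
  revert ε; decide

lemma pfaffianTerm_mul_blockPerm {R : Type*} [CommRing R] {n : ℕ} (hn : Even n)
    {A : Matrix (Fin n) (Fin n) R} (hA : ∀ i j, A i j = -A j i) (σ : Equiv.Perm (Fin n))
    (k : Equiv.Perm (Fin (n / 2)) × (Fin (n / 2) → Equiv.Perm (Fin 2))) :
    pfaffianTerm hn A (σ * blockPerm hn k) = pfaffianTerm hn A σ := by
  have key : ∀ (i : Fin (n / 2)) (ε : Equiv.Perm (Fin 2)),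
      A (σ (pairIndex hn (i, ε 0))) (σ (pairIndex hn (i, ε 1))) =
        ((Equiv.Perm.sign ε : ℤ) : R) *
          A (σ (pairIndex hn (i, 0))) (σ (pairIndex hn (i, 1))) := by
    intro i ε
    rcases perm_fin_two_eq ε with rfl | rfl
    · simp
    · simpa using hA _ _
  simp only [pfaffianTerm, Equiv.Perm.mul_apply, blockPerm_pairIndex, key]
  rw [Finset.prod_mul_distrib, Equiv.prod_comp k.1 (fun i => ((Equiv.Perm.sign (k.2 i) : ℤ) : R)),
    Equiv.prod_comp k.1 (fun i => A (σ (pairIndex hn (i, 0))) (σ (pairIndex hn (i, 1)))),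
    map_mul, sign_blockPerm]
  -- Each sign occurs twice: from the skew symmetry of `A` and from the sign of `blockPerm hn k`.
  have h1 : (∏ i, ((Equiv.Perm.sign (k.2 i) : ℤ) : R)) *
      ∏ i, ((Equiv.Perm.sign (k.2 i) : ℤ) : R) = 1 := by
    rw [← Finset.prod_mul_distrib]
    refine Finset.prod_eq_one fun i _ => ?_
    rw [← Int.cast_mul, ← Units.val_mul, Int.units_mul_self]; simp
  push_cast [Units.coe_prod]
  linear_combination ((Equiv.Perm.sign σ : ℤ) : R) *
    (∏ i, A (σ (pairIndex hn (i, 0))) (σ (pairIndex hn (i, 1)))) * h1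

/-- Every coset of the hyperoctahedral group contains exactly one permutation with sorted pairs. -/
lemma existsUnique_pairsSorted_mul_blockPerm {n : ℕ} (hn : Even n) (σ : Equiv.Perm (Fin n)) :
    ∃! k, PairsSorted hn (σ * blockPerm hn k) := by
  have hex : ∀ i, ∃! ε : Equiv.Perm (Fin 2),
      σ (pairIndex hn (i, ε 0)) < σ (pairIndex hn (i, ε 1)) := by
    intro i
    have hne : σ (pairIndex hn (i, 0)) ≠ σ (pairIndex hn (i, 1)) := by simp
    rcases lt_or_gt_of_ne hne with h | h
    · refine ⟨1, by simpa using h, fun ε hε => ?_⟩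
      rcases perm_fin_two_eq ε with rfl | rfl
      · rfl
      · simp at hε; exact absurd h hε.asymm
    · refine ⟨Equiv.swap 0 1, by simpa using h, fun ε hε => ?_⟩
      rcases perm_fin_two_eq ε with rfl | rfl
      · simp at hε; exact absurd h hε.asymm
      · rfl
  choose ε hε hεu using hex
  have hinj : Function.Injective fun i => σ (pairIndex hn (i, ε i 0)) := fun i j h => by
    simpa using congrArg Prod.fst ((pairIndex hn).injective (σ.injective h))
  refine ⟨(Tuple.sort fun i => σ (pairIndex hn (i, ε i 0)), ε), ⟨fun i => ?_, ?_⟩, ?_⟩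
  · simpa [blockPerm_pairIndex] using hε _
  · simp only [Equiv.Perm.mul_apply, blockPerm_pairIndex]
    exact (Tuple.monotone_sort _).strictMono_of_injective (hinj.comp (Equiv.injective _))
  · rintro ⟨τ, ε'⟩ ⟨h1, h2⟩
    simp only [Equiv.Perm.mul_apply, blockPerm_pairIndex] at h1 h2
    have hε' : ε' = ε := funext fun i => hεu i _ (by simpa using h1 (τ.symm i))
    subst hε'
    have := Tuple.unique_monotone (f := fun i => σ (pairIndex hn (i, ε' i 0))) (σ := τ)
      h2.monotone (Tuple.monotone_sort _)
    refine Prod.ext (Equiv.ext fun i => hinj (congrFun this i)) rfl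

open Classical in
/-- A sum over all permutations of a function invariant under the hyperoctahedral group is the order
of the group times the sum over the permutations with sorted pairs. -/
lemma sum_eq_card_mul_sum_pairsSorted {R : Type*} [CommRing R] {n : ℕ} (hn : Even n)
    (F : Equiv.Perm (Fin n) → R) (hF : ∀ σ k, F (σ * blockPerm hn k) = F σ) :
    ∑ σ, F σ = (Fintype.card (Equiv.Perm (Fin (n / 2)) × (Fin (n / 2) → Equiv.Perm (Fin 2))) : R) *
      ∑ σ with PairsSorted hn σ, F σ := by
  -- Count the pairs `(σ, k)` with `σ * blockPerm hn k` sorted, first by `σ` and then by `k`.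
  have h1 : ∀ σ, F σ = ∑ k, if PairsSorted hn (σ * blockPerm hn k) then F σ else 0 := by
    intro σ
    obtain ⟨k, hk, hu⟩ := existsUnique_pairsSorted_mul_blockPerm hn σ
    rw [Finset.sum_eq_single k (fun k' _ hne => if_neg fun h => hne (hu k' h)) (by simp), if_pos hk]
  rw [Finset.sum_congr rfl fun σ _ => h1 σ, Finset.sum_comm]
  have h2 : ∀ k, (∑ σ, if PairsSorted hn (σ * blockPerm hn k) then F σ else 0) =
      ∑ σ with PairsSorted hn σ, F σ := by
    intro k
    rw [Finset.sum_filter,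
      ← Equiv.sum_comp (Equiv.mulRight (blockPerm hn k)) fun σ =>
        if PairsSorted hn σ then F σ else 0]
    simp [hF]
  simp [h2]

/-! ### The Pfaffian of the sign matrix -/

/-- The sign of `y - x` for `x`, `y` in a linear order, as an element of a commutative ring. -/
def orderSign (R : Type*) [CommRing R] {α : Type*} [LinearOrder α] (x y : α) : R :=
  if x < y then 1 else if y < x then -1 else 0

/-- The values `2 * r` and `2 * r + 1` are paired with each other by `σ`. -/
def PairsBlock {n : ℕ} (hn : Even n) (σ : Equiv.Perm (Fin n)) (r : Fin (n / 2)) : Prop :=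
  ((pairIndex hn).symm (σ.symm (pairIndex hn (r, 0)))).1 =
    ((pairIndex hn).symm (σ.symm (pairIndex hn (r, 1)))).1

lemma pairsBlock_mul_blockPerm {n : ℕ} (hn : Even n) (σ : Equiv.Perm (Fin n)) (r : Fin (n / 2))
    (k : Equiv.Perm (Fin (n / 2)) × (Fin (n / 2) → Equiv.Perm (Fin 2))) :
    PairsBlock hn (σ * blockPerm hn k) r ↔ PairsBlock hn σ r := by
  have h : ∀ j, ((pairIndex hn).symm ((σ * blockPerm hn k).symm j)).1 =
      k.1.symm ((pairIndex hn).symm (σ.symm j)).1 := by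
    intro j
    obtain ⟨⟨i, c⟩, h⟩ := (pairIndex hn).surjective ((σ * blockPerm hn k).symm j)
    have h' : σ.symm j = pairIndex hn (k.1 i, k.2 (k.1 i) c) := by
      rw [← blockPerm_pairIndex, h, Equiv.symm_apply_eq, ← Equiv.Perm.mul_apply,
        Equiv.apply_symm_apply]
    rw [← h, h']; simp
  simp [PairsBlock, h]

/-- Exchanging the values `2 * r` and `2 * r + 1` reverses the sign of the permutation and keeps
the order within each pair other than `{2 * r, 2 * r + 1}`. -/
lemma pfaffianTerm_orderSign_swap_mul {n : ℕ} (hn : Even n) (σ : Equiv.Perm (Fin n))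
    (r : Fin (n / 2)) (h : ¬ PairsBlock hn σ r) :
    pfaffianTerm hn (Matrix.of (orderSign ℤ))
        (Equiv.swap (pairIndex hn (r, 0)) (pairIndex hn (r, 1)) * σ) =
      -pfaffianTerm hn (Matrix.of (orderSign ℤ)) σ := by
  have hne : pairIndex hn (r, 0) ≠ pairIndex hn (r, 1) := by simp
  -- `2 * r` and `2 * r + 1` are neighbours, so no other value lies between them.
  have key : ∀ p q : Fin n, p ≠ q → ¬ (p = pairIndex hn (r, 0) ∧ q = pairIndex hn (r, 1)) →
      ¬ (q = pairIndex hn (r, 0) ∧ p = pairIndex hn (r, 1)) →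
      orderSign ℤ (Equiv.swap (pairIndex hn (r, 0)) (pairIndex hn (r, 1)) p)
        (Equiv.swap (pairIndex hn (r, 0)) (pairIndex hn (r, 1)) q) = orderSign ℤ p q := by
    intro p q hpq h1 h2
    have h0 := pairIndex_val hn r 0
    have h0' := pairIndex_val hn r 1
    simp only [orderSign, Equiv.swap_apply_def, Fin.lt_def, Fin.ext_iff] at *
    split_ifs <;> simp at * <;> omega
  rw [pfaffianTerm, pfaffianTerm, map_mul, Equiv.Perm.sign_swap hne, ← neg_mul]
  congr 1
  · simp
  · refine Finset.prod_congr rfl fun i _ => ?_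
    simp only [Matrix.of_apply, Equiv.Perm.mul_apply]
    refine key _ _ (by simp) ?_ ?_ <;> rintro ⟨h1, h2⟩ <;>
      exact h (by simp [PairsBlock, ← h1, ← h2])

lemma pairsBlock_swap_mul {n : ℕ} (hn : Even n) (σ : Equiv.Perm (Fin n)) (r s : Fin (n / 2)) :
    PairsBlock hn (Equiv.swap (pairIndex hn (r, 0)) (pairIndex hn (r, 1)) * σ) s ↔
      PairsBlock hn σ s := by
  have h : ∀ j, (Equiv.swap (pairIndex hn (r, 0)) (pairIndex hn (r, 1)) * σ).symm j =
      σ.symm (Equiv.swap (pairIndex hn (r, 0)) (pairIndex hn (r, 1)) j) := fun j => rfl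
  rcases eq_or_ne s r with rfl | hs
  · simp only [PairsBlock, h, Equiv.swap_apply_left, Equiv.swap_apply_right, eq_comm]
  · simp only [PairsBlock, h]
    rw [Equiv.swap_apply_of_ne_of_ne (by simp [hs]) (by simp [hs]),
      Equiv.swap_apply_of_ne_of_ne (by simp [hs]) (by simp [hs])]

open Classical in
/-- The summands of the Pfaffian of the sign matrix belonging to permutations that do not pair
`2 * r` with `2 * r + 1` cancel, for each `r` in turn. -/
lemma sum_pfaffianTerm_orderSign_eq_sum_pairsBlock {n : ℕ} (hn : Even n)
    (T : Finset (Fin (n / 2))) :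
    ∑ σ, pfaffianTerm hn (Matrix.of (orderSign ℤ)) σ =
      ∑ σ with ∀ r ∈ T, PairsBlock hn σ r, pfaffianTerm hn (Matrix.of (orderSign ℤ)) σ := by
  induction T using Finset.induction_on with
  | empty => simp
  | insert r T _ ih =>
    rw [ih, ← Finset.sum_filter_add_sum_filter_not _ fun σ => PairsBlock hn σ r]
    simp only [Finset.filter_filter, Finset.forall_mem_insert]
    have hz : ∑ σ with (∀ s ∈ T, PairsBlock hn σ s) ∧ ¬ PairsBlock hn σ r,
        pfaffianTerm hn (Matrix.of (orderSign ℤ)) σ = 0 := by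
      rw [← self_eq_neg]
      rw [Finset.sum_filter, ← Finset.sum_neg_distrib]
      conv_lhs => rw [← Equiv.sum_comp (Equiv.mulLeft
        (Equiv.swap (pairIndex hn (r, 0)) (pairIndex hn (r, 1))))]
      refine Finset.sum_congr rfl fun σ _ => ?_
      simp only [Equiv.coe_mulLeft, pairsBlock_swap_mul]
      split_ifs with h
      · exact pfaffianTerm_orderSign_swap_mul hn σ r h.2
      · simp
    rw [hz, add_zero]
    exact Finset.sum_congr (by ext; simp [and_comm]) fun _ _ => rfl

lemma eq_one_of_pairsSorted_of_pairsBlock {n : ℕ} (hn : Even n) {σ : Equiv.Perm (Fin n)}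
    (h : PairsSorted hn σ) (hB : ∀ r, PairsBlock hn σ r) : σ = 1 := by
  -- The block `r` is the image of the pair `g r`; the map `g` is increasing, hence the identity.
  have hex : ∀ r, ∃ i, σ (pairIndex hn (i, 0)) = pairIndex hn (r, 0) ∧
      σ (pairIndex hn (i, 1)) = pairIndex hn (r, 1) := by
    intro r
    obtain ⟨⟨i, c⟩, h0⟩ := (pairIndex hn).surjective (σ.symm (pairIndex hn (r, 0)))
    obtain ⟨⟨j, d⟩, h1⟩ := (pairIndex hn).surjective (σ.symm (pairIndex hn (r, 1)))
    have hij := hB r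
    rw [PairsBlock, ← h0, ← h1] at hij
    simp only [Equiv.symm_apply_apply] at hij
    subst hij
    have hlt : pairIndex hn (r, 0) < pairIndex hn (r, 1) := by
      simp [Fin.lt_def, pairIndex_val]
    rw [Equiv.eq_symm_apply] at h0 h1
    have hi := h.1 i
    rw [← h0, ← h1] at hlt
    refine ⟨i, ?_⟩
    fin_cases c <;> fin_cases d
    · simp at hlt
    · exact ⟨h0, h1⟩
    · exact absurd hi hlt.asymm
    · simp at hlt
  choose g hg0 hg1 using hex
  have hgm : StrictMono g := by
    intro r s hrs
    rw [← h.2.lt_iff_lt]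
    simp only [hg0, Fin.lt_def, pairIndex_val]
    have := Fin.lt_def.1 hrs
    omega
  have hgs : Function.Surjective g := Finite.surjective_of_injective hgm.injective
  have hg : g = id := (hgm.range_inj strictMono_id).1 (by simp [hgs.range_eq])
  subst hg
  ext1 j
  obtain ⟨⟨r, c⟩, rfl⟩ := (pairIndex hn).surjective j
  fin_cases c
  · exact hg0 r
  · exact hg1 r

lemma orderSign_comm (R : Type*) [CommRing R] {α : Type*} [LinearOrder α] (x y : α) :
    orderSign R x y = -orderSign R y x := by
  rcases lt_trichotomy x y with h | rfl | h
  · simp [orderSign, h, h.asymm]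
  · simp [orderSign]
  · simp [orderSign, h, h.asymm]

/-- The sum of the Pfaffian summands of the sign matrix over all permutations is the order
`2 ^ (n / 2) * (n / 2)!` of the hyperoctahedral group; equivalently, its Pfaffian is `1`. -/
lemma sum_pfaffianTerm_orderSign (R : Type*) [CommRing R] {n : ℕ} (hn : Even n) :
    ∑ σ, pfaffianTerm hn (Matrix.of (orderSign R)) σ =
      (Fintype.card (Equiv.Perm (Fin (n / 2)) × (Fin (n / 2) → Equiv.Perm (Fin 2))) : R) := by
  classical
  have hZ : ∑ σ, pfaffianTerm hn (Matrix.of (orderSign ℤ)) σ =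
      (Fintype.card (Equiv.Perm (Fin (n / 2)) × (Fin (n / 2) → Equiv.Perm (Fin 2))) : ℤ) := by
    rw [sum_pfaffianTerm_orderSign_eq_sum_pairsBlock hn Finset.univ, Finset.sum_filter,
      sum_eq_card_mul_sum_pairsSorted hn]
    · have h1 : PairsSorted hn (1 : Equiv.Perm (Fin n)) :=
        ⟨fun i => by simp [Fin.lt_def, pairIndex_val], fun i j h => by
          have := Fin.lt_def.1 h
          simp only [Equiv.Perm.one_apply, Fin.lt_def, pairIndex_val]; omega⟩
      rw [Finset.sum_eq_single 1]
      · rw [if_pos fun r _ => by simp [PairsBlock, Equiv.Perm.one_def]]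
        simp [pfaffianTerm, orderSign, Fin.lt_def, pairIndex_val]
      · intro σ hσ hne
        refine if_neg fun hB => hne ?_
        exact eq_one_of_pairsSorted_of_pairsBlock hn (Finset.mem_filter.1 hσ).2 (by simpa using hB)
      · simp [h1]
    · intro σ k
      simp only [pairsBlock_mul_blockPerm]
      rw [pfaffianTerm_mul_blockPerm hn (A := Matrix.of (orderSign ℤ))
        fun i j => orderSign_comm ℤ i j]
  have hc : ∀ i j : Fin n, orderSign R i j = ((orderSign ℤ i j : ℤ) : R) := by
    intro i j; simp only [orderSign]; split_ifs <;> simp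
  have := congrArg (Int.cast : ℤ → R) hZ
  simpa [pfaffianTerm, hc] using this

lemma sum_pfaffianTerm_eq_card_mul_pfaffian {R : Type*} [CommRing R] {n : ℕ} (hn : Even n)
    {A : Matrix (Fin n) (Fin n) R} (hA : ∀ i j, A i j = -A j i) :
    ∑ σ, pfaffianTerm hn A σ =
      (Fintype.card (Equiv.Perm (Fin (n / 2)) × (Fin (n / 2) → Equiv.Perm (Fin 2))) : R) *
        pfaffian hn A := by
  classical
  rw [pfaffian_eq_sum_pfaffianTerm,
    sum_eq_card_mul_sum_pairsSorted hn _ (pfaffianTerm_mul_blockPerm hn hA)]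

/-! ### The integral over increasing tuples, for an arbitrary measure -/

/-- The determinant times the product of the order signs of the pairs `(x 0, x 1)`, `(x 2, x 3)`,
…. Its integral over all tuples is computed in two ways. -/
noncomputable def detMulOrderSign {𝕜 : Type*} [CommRing 𝕜] {n : ℕ} (hn : Even n) (g : Fin n → ℝ → 𝕜)
    (x : Fin n → ℝ) : 𝕜 :=
  (Matrix.of fun i j => g i (x j)).det *
    ∏ i, orderSign 𝕜 (x (pairIndex hn (i, 0))) (x (pairIndex hn (i, 1)))

lemma det_comp_perm {𝕜 : Type*} [CommRing 𝕜] {n : ℕ} (g : Fin n → ℝ → 𝕜) (x : Fin n → ℝ)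
    (σ : Equiv.Perm (Fin n)) :
    (Matrix.of fun i j => g i ((x ∘ σ) j)).det =
      ((Equiv.Perm.sign σ : ℤ) : 𝕜) * (Matrix.of fun i j => g i (x j)).det :=
  Matrix.det_permute' σ (Matrix.of fun i j => g i (x j))

lemma orderSign_comp_strictMono (R : Type*) [CommRing R] {α β : Type*} [LinearOrder α]
    [LinearOrder β] {x : α → β} (hx : StrictMono x) (i j : α) :
    orderSign R (x i) (x j) = orderSign R i j := by
  simp [orderSign, hx.lt_iff_lt]

open Classical in
/-- Both sides vanish if `x` is not injective. If `x` is injective, only the rearrangement that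
sorts `x` contributes to the right-hand side, and the left-hand side is the determinant of the
sorted tuple times the Pfaffian sum, over all permutations, of the sign matrix. -/
lemma sum_detMulOrderSign_comp_perm {𝕜 : Type*} [CommRing 𝕜] {n : ℕ} (hn : Even n)
    (g : Fin n → ℝ → 𝕜) (x : Fin n → ℝ) :
    ∑ σ : Equiv.Perm (Fin n), detMulOrderSign hn g (x ∘ σ) =
      (Fintype.card (Equiv.Perm (Fin (n / 2)) × (Fin (n / 2) → Equiv.Perm (Fin 2))) : 𝕜) *
        ∑ σ : Equiv.Perm (Fin n), Set.indicator {y : Fin n → ℝ | StrictMono y}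
          (fun y => (Matrix.of fun i j => g i (y j)).det) (x ∘ σ) := by
  by_cases hx : Function.Injective x
  · set τ := Tuple.sort x
    have hτ : StrictMono (x ∘ τ) :=
      (Tuple.monotone_sort x).strictMono_of_injective (hx.comp τ.injective)
    have hl : ∑ σ : Equiv.Perm (Fin n), detMulOrderSign hn g (x ∘ σ) =
        ∑ σ : Equiv.Perm (Fin n), detMulOrderSign hn g ((x ∘ τ) ∘ σ) :=
      (Equiv.sum_comp (Equiv.mulLeft τ) fun σ : Equiv.Perm (Fin n) =>
        detMulOrderSign hn g (x ∘ σ)).symm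
    rw [hl, ← sum_pfaffianTerm_orderSign 𝕜 hn, Finset.sum_mul,
      Finset.sum_eq_single (f := fun σ => Set.indicator _ _ _) τ,
      Set.indicator_of_mem (show x ∘ τ ∈ {y : Fin n → ℝ | StrictMono y} from hτ)]
    · refine Finset.sum_congr rfl fun σ _ => ?_
      rw [detMulOrderSign, det_comp_perm, pfaffianTerm]
      simp only [Function.comp_apply, Matrix.of_apply]
      simp only [← Function.comp_apply (f := x), orderSign_comp_strictMono 𝕜 hτ]
      ring
    · intro σ _ hσ
      refine Set.indicator_of_notMem (fun h : StrictMono _ => hσ (Equiv.ext fun i => hx ?_)) _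
      exact congrFun (Tuple.unique_monotone h.monotone hτ.monotone) i
    · simp
  · have h0 : ∀ σ : Equiv.Perm (Fin n), (Matrix.of fun i j => g i ((x ∘ σ) j)).det = 0 := by
      intro σ
      rw [det_comp_perm]
      obtain ⟨i, j, hij, hne⟩ := Function.not_injective_iff.1 hx
      rw [Matrix.det_zero_of_column_eq hne (by simp [hij]), mul_zero]
    rw [Finset.sum_eq_zero fun σ _ => by rw [detMulOrderSign, h0, zero_mul],
      Finset.sum_eq_zero fun σ _ => ?_, mul_zero]
    rw [Set.indicator_apply, h0, ite_self]

lemma measurableSet_strictMono (n : ℕ) : MeasurableSet {x : Fin n → ℝ | StrictMono x} := by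
  simp only [StrictMono, Set.ofPred_forall]
  exact .iInter fun i => .iInter fun j => .iInter fun _ =>
    measurableSet_lt (measurable_pi_apply i) (measurable_pi_apply j)

section

variable {𝕜 : Type*} [RCLike 𝕜] {n : ℕ}

lemma measurable_orderSign : Measurable fun p : ℝ × ℝ => orderSign 𝕜 p.1 p.2 :=
  Measurable.ite (measurableSet_lt measurable_fst measurable_snd) measurable_const
    (Measurable.ite (measurableSet_lt measurable_snd measurable_fst) measurable_const
      measurable_const)

lemma norm_orderSign_le_one {α : Type*} [LinearOrder α] (x y : α) : ‖orderSign 𝕜 x y‖ ≤ 1 := by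
  simp only [orderSign]; split_ifs <;> simp

lemma integrable_prod_mul_orderSign (hn : Even n) {μ : Measure ℝ}
    {F : (Fin n → ℝ) → 𝕜} (hF : Integrable F (Measure.pi fun _ => μ)) :
    Integrable (fun x => F x *
      ∏ i, orderSign 𝕜 (x (pairIndex hn (i, 0))) (x (pairIndex hn (i, 1))))
      (Measure.pi fun _ => μ) := by
  refine hF.mul_bdd (c := 1) (Measurable.aestronglyMeasurable ?_) (.of_forall fun x => ?_)
  · refine Finset.measurable_prod _ fun i _ => ?_
    have h : Measurable fun x : Fin n → ℝ =>
        (x (pairIndex hn (i, 0)), x (pairIndex hn (i, 1))) := by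
      fun_prop
    exact measurable_orderSign.comp h
  · rw [norm_prod]
    exact Finset.prod_le_one (fun _ _ => norm_nonneg _) fun _ _ => norm_orderSign_le_one _ _

variable (μ : Measure ℝ) [SigmaFinite μ]

lemma measurePreserving_comp_perm (σ : Equiv.Perm (Fin n)) :
    MeasurePreserving (MeasurableEquiv.piCongrLeft (fun _ => ℝ) σ.symm)
      (Measure.pi fun _ : Fin n => μ) (Measure.pi fun _ : Fin n => μ) :=
  measurePreserving_piCongrLeft (fun _ => μ) σ.symm

lemma piCongrLeft_symm_apply_eq_comp (σ : Equiv.Perm (Fin n)) (x : Fin n → ℝ) :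
    MeasurableEquiv.piCongrLeft (fun _ => ℝ) σ.symm x = x ∘ σ := by
  funext i
  obtain ⟨j, rfl⟩ := σ.symm.surjective i
  rw [MeasurableEquiv.coe_piCongrLeft, Equiv.piCongrLeft_apply_apply]
  simp

lemma integral_comp_perm (σ : Equiv.Perm (Fin n)) (F : (Fin n → ℝ) → 𝕜) :
    ∫ x, F (x ∘ σ) ∂Measure.pi (fun _ => μ) = ∫ x, F x ∂Measure.pi fun _ => μ := by
  simpa only [piCongrLeft_symm_apply_eq_comp] using
    (measurePreserving_comp_perm μ σ).integral_comp' F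

lemma integrable_comp_perm (σ : Equiv.Perm (Fin n)) {F : (Fin n → ℝ) → 𝕜}
    (hF : Integrable F (Measure.pi fun _ => μ)) :
    Integrable (fun x => F (x ∘ σ)) (Measure.pi fun _ => μ) := by
  simpa only [Function.comp_def, piCongrLeft_symm_apply_eq_comp] using
    (measurePreserving_comp_perm μ σ).integrable_comp_of_integrable hF

/-- A tuple of even length `n` as a tuple of `n / 2` pairs. -/
def pairsEquiv (hn : Even n) : (Fin (n / 2) → ℝ × ℝ) ≃ᵐ (Fin n → ℝ) where
  toFun p j := ![(p ((pairIndex hn).symm j).1).1, (p ((pairIndex hn).symm j).1).2]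
    ((pairIndex hn).symm j).2
  invFun x i := (x (pairIndex hn (i, 0)), x (pairIndex hn (i, 1)))
  left_inv p := by simp
  right_inv x := by
    funext j
    obtain ⟨⟨i, c⟩, rfl⟩ := (pairIndex hn).surjective j
    fin_cases c <;> simp
  measurable_toFun := by
    refine measurable_pi_lambda _ fun j => ?_
    obtain ⟨⟨i, c⟩, rfl⟩ := (pairIndex hn).surjective j
    fin_cases c
    · simpa using (measurable_pi_apply i).fst
    · simpa using (measurable_pi_apply i).snd
  measurable_invFun := by
    dsimp
    fun_prop

lemma pairsEquiv_zero (hn : Even n) (p : Fin (n / 2) → ℝ × ℝ) (i : Fin (n / 2)) :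
    pairsEquiv hn p (pairIndex hn (i, 0)) = (p i).1 := by
  simp [pairsEquiv]

lemma pairsEquiv_one (hn : Even n) (p : Fin (n / 2) → ℝ × ℝ) (i : Fin (n / 2)) :
    pairsEquiv hn p (pairIndex hn (i, 1)) = (p i).2 := by
  simp [pairsEquiv]

lemma measurePreserving_pairsEquiv (hn : Even n) :
    MeasurePreserving (pairsEquiv hn) (Measure.pi fun _ => μ.prod μ) (Measure.pi fun _ => μ) where
  measurable := (pairsEquiv hn).measurable
  map_eq := by
    refine (Measure.pi_eq fun s _ => ?_).symm
    rw [MeasurableEquiv.map_apply]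
    have : pairsEquiv hn ⁻¹' Set.univ.pi s =
        Set.univ.pi fun i => s (pairIndex hn (i, 0)) ×ˢ s (pairIndex hn (i, 1)) := by
      ext p
      simp only [Set.mem_preimage, Set.mem_univ_pi, Set.mem_prod,
        ← (pairIndex hn).forall_congr_right, Prod.forall, Fin.forall_fin_two, pairsEquiv_zero, pairsEquiv_one]
    rw [this, Measure.pi_pi, prod_pairIndex hn]
    simp only [Measure.prod_prod]

/-- Fubini's theorem for a product of functions of disjoint pairs of variables. -/
lemma integral_prod_pairs (hn : Even n) (h : Fin (n / 2) → ℝ → ℝ → 𝕜) :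
    ∫ x, ∏ i, h i (x (pairIndex hn (i, 0))) (x (pairIndex hn (i, 1))) ∂Measure.pi (fun _ => μ) =
      ∏ i, ∫ p, h i p.1 p.2 ∂μ.prod μ := by
  rw [← (measurePreserving_pairsEquiv μ hn).integral_comp']
  simp only [pairsEquiv_zero, pairsEquiv_one]
  exact integral_fintype_prod_eq_prod fun i (p : ℝ × ℝ) => h i p.1 p.2

variable {μ}

lemma integrable_det {g : Fin n → ℝ → 𝕜} (hg : ∀ i, Integrable (g i) μ) :
    Integrable (fun x => (Matrix.of fun i j => g i (x j)).det) (Measure.pi fun _ : Fin n => μ) := by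
  simp only [Matrix.det_apply', Matrix.of_apply]
  exact integrable_finsetSum _ fun σ _ => (Integrable.fintype_prod fun j => hg (σ j)).const_mul _

/-- The antisymmetrised double integral over `x < y` is the integral of `g x * h y * sgn (y - x)`
over the whole plane. -/
lemma integral_mul_orderSign {g h : ℝ → 𝕜} (hg : Integrable g μ) (hh : Integrable h μ) :
    ∫ p, g p.1 * h p.2 * orderSign 𝕜 p.1 p.2 ∂μ.prod μ =
      ∫ p in {p : ℝ × ℝ | p.1 < p.2}, (g p.1 * h p.2 - h p.1 * g p.2) ∂μ.prod μ := by
  have hS : MeasurableSet {p : ℝ × ℝ | p.1 < p.2} := measurableSet_lt measurable_fst measurable_snd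
  have hS' : MeasurableSet {p : ℝ × ℝ | p.2 < p.1} := measurableSet_lt measurable_snd measurable_fst
  have h1 := hg.mul_prod hh
  have h2 := hh.mul_prod hg
  rw [integral_sub h1.integrableOn h2.integrableOn, ← integral_indicator hS,
    ← integral_indicator hS,
    ← integral_prod_swap (Set.indicator _ fun p : ℝ × ℝ => h p.1 * g p.2),
    ← integral_sub (h1.indicator hS)]
  · refine integral_congr_ae (.of_forall fun p => ?_)
    rcases lt_trichotomy p.1 p.2 with hp | hp | hp
    · simp [orderSign, Set.indicator, hp, hp.asymm]
    · simp [orderSign, Set.indicator, hp]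
    · simp [orderSign, Set.indicator, hp, hp.asymm, mul_comm]
  · exact (h2.indicator hS).swap

/-- Expanding the determinant and integrating pair by pair gives the Pfaffian sum, over all
permutations, of the matrix of double integrals. -/
lemma integral_detMulOrderSign (hn : Even n) {g : Fin n → ℝ → 𝕜} (hg : ∀ i, Integrable (g i) μ) :
    ∫ x, detMulOrderSign hn g x ∂Measure.pi (fun _ => μ) =
      ∑ σ, pfaffianTerm hn (Matrix.of fun i j => ∫ p in {p : ℝ × ℝ | p.1 < p.2},
        (g i p.1 * g j p.2 - g j p.1 * g i p.2) ∂μ.prod μ) σ := by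
  simp only [detMulOrderSign, Matrix.det_apply', Matrix.of_apply, Finset.sum_mul, mul_assoc]
  rw [integral_finsetSum]
  · refine Finset.sum_congr rfl fun σ _ => ?_
    rw [integral_const_mul, pfaffianTerm]
    congr 1
    simp only [prod_pairIndex hn, ← Finset.prod_mul_distrib, Matrix.of_apply,
      ← integral_mul_orderSign (hg _) (hg _)]
    exact integral_prod_pairs μ hn fun i x y =>
      g (σ (pairIndex hn (i, 0))) x * g (σ (pairIndex hn (i, 1))) y * orderSign 𝕜 x y
  · exact fun σ _ => (integrable_prod_mul_orderSign hn
      (Integrable.fintype_prod fun j => hg (σ j))).const_mul _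

/-- **De Bruijn's formula** for an even number of functions and an arbitrary σ-finite measure,
which may have atoms. -/
theorem integral_strictMono_det_eq_pfaffian (hn : Even n) {g : Fin n → ℝ → 𝕜}
    (hg : ∀ i, Integrable (g i) μ) :
    ∫ x in {x : Fin n → ℝ | StrictMono x}, (Matrix.of fun i j => g i (x j)).det
        ∂Measure.pi (fun _ => μ) =
      pfaffian hn (Matrix.of fun i j => ∫ p in {p : ℝ × ℝ | p.1 < p.2},
        (g i p.1 * g j p.2 - g j p.1 * g i p.2) ∂μ.prod μ) := by
  have hD := (integrable_det hg).indicator (measurableSet_strictMono n)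
  have hW : Integrable (detMulOrderSign hn g) (Measure.pi fun _ => μ) :=
    integrable_prod_mul_orderSign hn (integrable_det hg)
  have key := congrArg (fun F : (Fin n → ℝ) → 𝕜 => ∫ x, F x ∂Measure.pi fun _ => μ)
    (funext fun x => sum_detMulOrderSign_comp_perm hn g x)
  rw [integral_const_mul, integral_finsetSum _ fun σ _ => integrable_comp_perm μ σ hW,
    integral_finsetSum _ fun σ _ => integrable_comp_perm μ σ hD] at key
  simp only [integral_comp_perm μ _ (detMulOrderSign hn g),
    integral_comp_perm μ _ (Set.indicator _ _), Finset.sum_const, nsmul_eq_mul, integral_indicator (measurableSet_strictMono n)] at key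
  rw [integral_detMulOrderSign hn hg, sum_pfaffianTerm_eq_card_mul_pfaffian hn] at key
  · have hc1 : ((Finset.univ : Finset (Equiv.Perm (Fin n))).card : 𝕜) ≠ 0 :=
      Nat.cast_ne_zero.2 (Finset.card_ne_zero.2 Finset.univ_nonempty)
    have hc2 : (Fintype.card (Equiv.Perm (Fin (n / 2)) × (Fin (n / 2) → Equiv.Perm (Fin 2))) : 𝕜)
        ≠ 0 := Nat.cast_ne_zero.2 Fintype.card_ne_zero
    rw [mul_left_comm] at key
    exact (mul_left_cancel₀ hc1 (mul_left_cancel₀ hc2 key)).symm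
  · intro i j
    simp only [Matrix.of_apply]
    rw [← integral_neg]
    simp

end

/-! ### Restriction to an interval -/

lemma orderedRegion_eq (k : ℕ) (a b : ℝ) :
    orderedRegion k a b =
      {x | StrictMono x} ∩ Set.univ.pi fun _ => Set.Ioo a b := by
  ext x; simp [orderedRegion, and_comm]

lemma orderedPairs_eq (a b : ℝ) :
    orderedPairs a b = {p | p.1 < p.2} ∩ Set.Ioo a b ×ˢ Set.Ioo a b := by
  ext p
  simp only [orderedPairs, Set.mem_ofPred_eq, Set.mem_inter_iff, Set.mem_prod, Set.mem_Ioo]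
  exact ⟨fun h => ⟨h.2.1, ⟨h.1, h.2.1.trans h.2.2⟩, h.1.trans h.2.1, h.2.2⟩,
    fun h => ⟨h.2.1.1, h.1, h.2.2.2⟩⟩

lemma measurableSet_orderedRegion (k : ℕ) (a b : ℝ) : MeasurableSet (orderedRegion k a b) := by
  rw [orderedRegion_eq]
  exact (measurableSet_strictMono k).inter (.univ_pi fun _ => measurableSet_Ioo)

lemma measurableSet_fst_lt_snd : MeasurableSet {p : ℝ × ℝ | p.1 < p.2} :=
  measurableSet_lt measurable_fst measurable_snd

lemma measurableSet_orderedPairs (a b : ℝ) : MeasurableSet (orderedPairs a b) := by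
  rw [orderedPairs_eq]
  exact measurableSet_fst_lt_snd.inter (measurableSet_Ioo.prod measurableSet_Ioo)

lemma pi_restrict_orderedRegion (k : ℕ) (a b : ℝ) (ν : Measure ℝ) [SigmaFinite ν] :
    (Measure.pi fun _ : Fin k => ν).restrict (orderedRegion k a b) =
      (Measure.pi fun _ : Fin k => ν.restrict (Set.Ioo a b)).restrict {x | StrictMono x} := by
  rw [← Measure.restrict_pi_pi, Measure.restrict_restrict (measurableSet_strictMono k),
    orderedRegion_eq]

lemma prod_restrict_orderedPairs (a b : ℝ) (ν : Measure ℝ) [SigmaFinite ν] :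
    (ν.prod ν).restrict (orderedPairs a b) =
      ((ν.restrict (Set.Ioo a b)).prod (ν.restrict (Set.Ioo a b))).restrict {p | p.1 < p.2} := by
  rw [Measure.prod_restrict, Measure.restrict_restrict measurableSet_fst_lt_snd, orderedPairs_eq]

/-! ### The odd case: an atom at the left end point -/

section

variable {𝕜 : Type*} [RCLike 𝕜] {k : ℕ} (a b : ℝ)

/-- Lebesgue measure on the open interval together with a unit point mass at its left end. -/
noncomputable def atomMeasure : Measure ℝ := volume.restrict (Set.Ioo a b) + Measure.dirac a

instance : IsFiniteMeasure (atomMeasure a b) := by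
  unfold atomMeasure; infer_instance

/-- The functions `f i` on the open interval, preceded by the indicator function of its left
end. -/
noncomputable def atomCons (f : Fin k → ℝ → 𝕜) : Fin (k + 1) → ℝ → 𝕜 :=
  Fin.cons (Set.indicator {a} 1) fun i => (Set.Ioo a b).indicator (f i)

lemma atomMeasure_restrict_Ioo :
    (atomMeasure a b).restrict (Set.Ioo a b) = volume.restrict (Set.Ioo a b) := by
  classical
  rw [atomMeasure, Measure.restrict_add, Measure.restrict_restrict measurableSet_Ioo,
    Set.inter_self, restrict_dirac' measurableSet_Ioo]
  simp

lemma integral_indicator_singleton_atomMeasure :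
    ∫ x, Set.indicator {a} (1 : ℝ → 𝕜) x ∂atomMeasure a b = 1 := by
  rw [integral_indicator (measurableSet_singleton a)]
  simp [atomMeasure, Measure.real]

lemma integrable_atomCons {f : Fin k → ℝ → 𝕜} (hf : ∀ i, IntegrableOn (f i) (Set.Ioo a b))
    (i : Fin (k + 1)) : Integrable (atomCons a b f i) (atomMeasure a b) := by
  refine Fin.cases ?_ (fun i => ?_) i
  · exact (integrable_const (1 : 𝕜)).indicator (measurableSet_singleton a)
  · simp only [atomCons, Fin.cons_succ]
    rw [integrable_indicator_iff measurableSet_Ioo, IntegrableOn, atomMeasure_restrict_Ioo]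
    exact hf i

/-- In an increasing tuple only the first variable can sit at the atom, and the determinant
vanishes unless it does. -/
lemma indicator_det_atomCons (f : Fin k → ℝ → 𝕜) (t : ℝ) (y : Fin k → ℝ) :
    Set.indicator {x : Fin (k + 1) → ℝ | StrictMono x}
        (fun x => (Matrix.of fun i j => atomCons a b f i (x j)).det) (Fin.cons t y) =
      Set.indicator {a} 1 t * Set.indicator (orderedRegion k a b)
        (fun x => (Matrix.of fun i j => f i (x j)).det) y := by
  by_cases hs : StrictMono (Fin.cons t y : Fin (k + 1) → ℝ)
  · have hty : ∀ j, t < y j := fun j => by simpa using hs (Fin.succ_pos j)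
    have hy : StrictMono y := fun i j hij => by simpa using hs (Fin.succ_lt_succ_iff.2 hij)
    rw [Set.indicator_of_mem (by exact hs)]
    by_cases hta : t = a
    · subst hta
      rw [Matrix.det_succ_column_zero, Fin.sum_univ_succ, Finset.sum_eq_zero]
      · simp only [Matrix.of_apply, Fin.cons_zero, atomCons, Fin.val_zero, pow_zero, one_mul,
          Set.indicator_of_mem (Set.mem_singleton t), Pi.one_apply, add_zero]
        by_cases hy' : y ∈ orderedRegion k t b
        · rw [Set.indicator_of_mem hy']
          congr 1
          ext i j
          simp [Matrix.submatrix, Set.indicator_of_mem (show y j ∈ Set.Ioo t b from hy'.1 j)]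
        · rw [Set.indicator_of_notMem hy']
          have : ∃ j, y j ∉ Set.Ioo t b := by
            by_contra! h
            exact hy' ⟨h, hy⟩
          obtain ⟨j, hj⟩ := this
          refine Matrix.det_eq_zero_of_column_eq_zero j fun i => ?_
          simp [Matrix.submatrix, Set.indicator_of_notMem hj]
      · intro i _
        simp [atomCons]
    · rw [Set.indicator_of_notMem (by simpa using hta), zero_mul]
      by_cases hat : a < t
      -- All variables lie to the right of the atom, so the zeroth row vanishes.
      · refine Matrix.det_eq_zero_of_row_eq_zero 0 fun j => ?_
        refine Fin.cases ?_ (fun j => ?_) j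
        · simp [atomCons, hta]
        · simp [atomCons, (hat.trans (hty j)).ne']
      -- The zeroth variable lies to the left of the atom, so the zeroth column vanishes.
      · refine Matrix.det_eq_zero_of_column_eq_zero 0 fun i => ?_
        refine Fin.cases ?_ (fun i => ?_) i
        · simp [atomCons, hta]
        · simp [atomCons, Set.indicator, hat]
  · rw [Set.indicator_of_notMem (by exact hs)]
    by_cases hta : t = a
    · subst hta
      rw [Set.indicator_of_notMem (s := orderedRegion k t b), mul_zero]
      rintro ⟨h1, h2⟩
      refine hs fun i j hij => ?_
      obtain ⟨j, rfl⟩ := Fin.exists_succ_eq_of_ne_zero ((Fin.zero_le i).trans_lt hij).ne'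
      refine Fin.cases (fun _ => ?_) (fun i hij => ?_) i hij
      · simpa using (h1 j).1
      · simpa using h2 (Fin.succ_lt_succ_iff.1 hij)
    · rw [Set.indicator_of_notMem (by simpa using hta), zero_mul]

/-- The atom absorbs the zeroth variable, which leaves the integral over `orderedRegion`. -/
lemma integral_det_atomCons (f : Fin k → ℝ → 𝕜) :
    ∫ x in {x : Fin (k + 1) → ℝ | StrictMono x},
        (Matrix.of fun i j => atomCons a b f i (x j)).det ∂Measure.pi (fun _ => atomMeasure a b) =
      ∫ x in orderedRegion k a b, (Matrix.of fun i j => f i (x j)).det := by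
  rw [← integral_indicator (measurableSet_strictMono _),
    ← (measurePreserving_piFinSuccAbove (fun _ => atomMeasure a b) 0).symm.integral_comp']
  have hcons : ∀ p : ℝ × (Fin k → ℝ), (MeasurableEquiv.piFinSuccAbove (fun _ => ℝ) 0).symm p =
      (Fin.cons p.1 p.2 : Fin (k + 1) → ℝ) := fun p => Fin.insertNth_zero' p.1 p.2
  simp only [hcons, indicator_det_atomCons]
  rw [integral_prod_mul, integral_indicator_singleton_atomMeasure, one_mul,
    integral_indicator (measurableSet_orderedRegion k a b), pi_restrict_orderedRegion,
    atomMeasure_restrict_Ioo, ← pi_restrict_orderedRegion, volume_pi]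

/-- The zeroth row: if the first variable sits at the atom, then the constraint `x < y` holds on the
support of the second factor, and the subtracted term vanishes for `x < y`. -/
lemma integral_pair_atomCons_zero (f : Fin k → ℝ → 𝕜) (j : Fin k) :
    ∫ p in {p : ℝ × ℝ | p.1 < p.2}, (atomCons a b f 0 p.1 * atomCons a b f j.succ p.2 -
        atomCons a b f j.succ p.1 * atomCons a b f 0 p.2)
        ∂(atomMeasure a b).prod (atomMeasure a b) =
      ∫ x in Set.Ioo a b, f j x := by
  have h : ∀ p : ℝ × ℝ, Set.indicator {p : ℝ × ℝ | p.1 < p.2}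
      (fun p => atomCons a b f 0 p.1 * atomCons a b f j.succ p.2 -
        atomCons a b f j.succ p.1 * atomCons a b f 0 p.2) p =
      Set.indicator {a} 1 p.1 * (Set.Ioo a b).indicator (f j) p.2 := by
    rintro ⟨x, y⟩
    simp only [atomCons, Fin.cons_zero, Fin.cons_succ, Set.indicator_apply, Set.mem_ofPred_eq,
      Set.mem_singleton_iff, Set.mem_Ioo, Pi.one_apply]
    by_cases hx : x = a
    · subst hx
      by_cases hy : x < y
      · simp [hy]
      · simp [hy]
    · by_cases hy : y = a
      · subst hy
        have : x < y → ¬ y < x := fun h => h.asymm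
        by_cases hxy : x < y <;> simp [hx, hxy, this]
      · simp [hx, hy]
  rw [← integral_indicator measurableSet_fst_lt_snd, integral_congr_ae (.of_forall h),
    integral_prod_mul, integral_indicator_singleton_atomMeasure, one_mul,
    integral_indicator measurableSet_Ioo, atomMeasure_restrict_Ioo]

lemma integral_pair_atomCons_succ (f : Fin k → ℝ → 𝕜) (i j : Fin k) :
    ∫ p in {p : ℝ × ℝ | p.1 < p.2}, (atomCons a b f i.succ p.1 * atomCons a b f j.succ p.2 -
        atomCons a b f j.succ p.1 * atomCons a b f i.succ p.2)
        ∂(atomMeasure a b).prod (atomMeasure a b) =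
      ∫ p in orderedPairs a b, (f i p.1 * f j p.2 - f j p.1 * f i p.2) := by
  have h : ∀ p : ℝ × ℝ, Set.indicator {p : ℝ × ℝ | p.1 < p.2}
      (fun p => atomCons a b f i.succ p.1 * atomCons a b f j.succ p.2 -
        atomCons a b f j.succ p.1 * atomCons a b f i.succ p.2) p =
      Set.indicator (orderedPairs a b) (fun p => f i p.1 * f j p.2 - f j p.1 * f i p.2) p := by
    rintro ⟨x, y⟩
    rw [orderedPairs_eq, ← Set.indicator_indicator]
    congr 1
    funext p
    by_cases h1 : p.1 ∈ Set.Ioo a b <;> by_cases h2 : p.2 ∈ Set.Ioo a b <;>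
      simp [atomCons, Set.mem_prod, -Set.mem_Ioo, h1, h2]
  rw [← integral_indicator measurableSet_fst_lt_snd, integral_congr_ae (.of_forall h),
    integral_indicator (measurableSet_orderedPairs a b), prod_restrict_orderedPairs,
    atomMeasure_restrict_Ioo, ← prod_restrict_orderedPairs, Measure.volume_eq_prod]

/-- The matrix of double integrals against the measure with an atom is the bordered matrix. -/
lemma pairMatrix_atomCons (f : Fin k → ℝ → 𝕜) :
    (Matrix.of fun i j => ∫ p in {p : ℝ × ℝ | p.1 < p.2},
        (atomCons a b f i p.1 * atomCons a b f j p.2 -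
          atomCons a b f j p.1 * atomCons a b f i p.2)
        ∂(atomMeasure a b).prod (atomMeasure a b)) =
      skewBorder (fun i => ∫ x in Set.Ioo a b, f i x) (pairMatrix a b f) := by
  ext i j
  refine Fin.cases ?_ (fun i => ?_) i <;> refine Fin.cases ?_ (fun j => ?_) j
  · simp [skewBorder, mul_comm]
  · simpa [skewBorder] using integral_pair_atomCons_zero a b f j
  · simp only [skewBorder, Matrix.of_apply, Fin.cons_succ, Fin.cons_zero]
    rw [← integral_pair_atomCons_zero a b f i, ← integral_neg]
    simp
  · simpa [skewBorder, pairMatrix] using integral_pair_atomCons_succ a b f i j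

end

/-! ### The formula for continuous functions -/

theorem mainTheorem2 {𝕜 : Type*} [RCLike 𝕜] (k : ℕ) (a b : ℝ) (hab : a ≤ b)
    (f : Fin k → ℝ → 𝕜) (hf : ∀ i, ContinuousOn (f i) (Set.Icc a b)) :
    IntegrableOn (fun x : Fin k → ℝ => (Matrix.of fun i j => f i (x j)).det)
      (orderedRegion k a b) ∧
    (∀ i j, IntegrableOn (fun p : ℝ × ℝ => f i p.1 * f j p.2 - f j p.1 * f i p.2)
      (orderedPairs a b)) ∧
    (∀ i, IntegrableOn (f i) (Set.Ioo a b)) ∧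
    (∀ hk : Even k,
      ∫ x in orderedRegion k a b, (Matrix.of fun i j => f i (x j)).det =
        pfaffian hk (pairMatrix a b f)) ∧
    (∀ hk : Odd k,
      ∫ x in orderedRegion k a b, (Matrix.of fun i j => f i (x j)).det =
        pfaffian hk.add_one
          (skewBorder (fun i => ∫ x in Set.Ioo a b, f i x) (pairMatrix a b f))) := by
  have hint : ∀ i, IntegrableOn (f i) (Set.Ioo a b) := fun i =>
    ((hf i).integrableOn_compact isCompact_Icc).mono_set Set.Ioo_subset_Icc_self
  refine ⟨?_, fun i j => ?_, hint, fun hk => ?_, fun hk => ?_⟩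
  · rw [IntegrableOn, volume_pi, pi_restrict_orderedRegion]
    exact (integrable_det hint).integrableOn
  · rw [IntegrableOn, Measure.volume_eq_prod, prod_restrict_orderedPairs]
    exact (((hint i).mul_prod (hint j)).sub ((hint j).mul_prod (hint i))).integrableOn
  · rw [volume_pi, pi_restrict_orderedRegion, integral_strictMono_det_eq_pfaffian hk hint]
    simp only [pairMatrix, Measure.volume_eq_prod, prod_restrict_orderedPairs]
  · rw [← integral_det_atomCons a b f, ← pairMatrix_atomCons,
      integral_strictMono_det_eq_pfaffian hk.add_one (integrable_atomCons a b hint)]
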